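/- Let $N \ge 1$ be an integer, $1 \le p < \infty$ and $1 \le q < \infty$. For a (Lebesgue) measurable function $f : \mathbb{R}^N\times\mathbb{R}^N \to \mathbb{R}$ set $$\|f\|_{L^{p,q}(\mathbb{R}^N\times\mathbb{R}^N)} := \Bigl( p\int_0^\infty \lambda^q\, \mathcal{L}^{2N}\bigl(\{(x,y)\in\mathbb{R}^N\times\mathbb{R}^N : |f(x,y)|\ge\lambda\}\bigr)^{q/p}\,\frac{d\lambda}{\lambda}\Bigr)^{1/q} \in [0,\infty],$$ where $\mathcal{L}^{2N}$ is Lebesgue measure on $\mathbb{R}^N\times\mathbb{R}^N$ and $|\cdot|$ is the Euclidean norm on $\mathbb{R}^N$. Then the following hold. (i) If $u:\mathbb{R}^N\to\mathbb{R}$ is (Lebesgue) measurable and $$\Bigl\| \frac{u(x)-u(y)}{|x-y|^{N/p+1}} \Bigr\|_{L^{p,q}(\mathbb{R}^N\times\mathbb{R}^N)} < \infty,$$ then $u$ is constant, that is, there is $c\in\mathbb{R}$ with $u(x)=c$ for almost every $x\in\mathbb{R}^N$. (ii) Consequently, there is no finite constant $C = C(N,p,q)$ such that $$\Bigl\| \frac{u(x)-u(y)}{|x-y|^{N/p+1}}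 \Bigr\|_{L^{p,q}(\mathbb{R}^N\times\mathbb{R}^N)} \le C\,\|\nabla u\|_{L^p(\mathbb{R}^N)} \qquad \text{for all } u\in C_c^\infty(\mathbb{R}^N).$$ -/

import Mathlib

open MeasureTheory Filter
open scoped NNReal ENNReal

noncomputable section

/-- The Lorentz quasinorm of a real function `f` for finite exponents `p`, `q`,
`(p ∫₀^∞ t ^ q μ{|f| ≥ t} ^ (q / p) dt / t) ^ (1 / q)`, with values in `[0, ∞]`. -/
def lorentzQuasinorm {α : Type*} [MeasurableSpace α] (f : α → ℝ) (p q : ℝ)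
    (μ : Measure α) : ℝ≥0∞ :=
  (ENNReal.ofReal p * ∫⁻ t in Set.Ioi (0 : ℝ),
    ENNReal.ofReal t ^ q * μ {z | t ≤ |f z|} ^ (q / p) / ENNReal.ofReal t) ^ (1 / q)

/-- The difference quotient `(u x - u y) / |x - y| ^ (N / p + 1)` on `ℝ^N × ℝ^N`. -/
def diffQuotient {N : ℕ} (p : ℝ) (u : EuclideanSpace ℝ (Fin N) → ℝ)
    (z : EuclideanSpace ℝ (Fin N) × EuclideanSpace ℝ (Fin N)) : ℝ :=
  (u z.1 - u z.2) / ‖z.1 - z.2‖ ^ ((N : ℝ) / p + 1)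

end

/-! Put `h = x - y`. The `p`-th power of the quotient, integrated over a shell `ρ / 2 < |h| ≤ ρ`,
does not decrease when `ρ` is halved: by the triangle inequality a step of length `2 |h|` is two
steps of length `|h|`, and the loss `2 ^ p` from convexity of `t ^ p`, together with the Jacobian
`2 ^ N` of `h ↦ 2 h`, is exactly the gain from the weight `|h| ^ (-N - p)`. If `u` is not constant,
all the shells at scale `2 ^ (-j) ρ`, `j < J`, therefore carry at least some fixed `c > 0`, so that
the integral over `|h| ≤ ρ` diverges logarithmically.

On the `j`-th shell the quotient is at most `2 ^ (m j + K)`, once `|u x - u y|` has been replaced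
by `min 1 |u x - u y|`, which still satisfies the triangle inequality. Cutting the integral at the
dyadic levels gives `J c ≤ A + B ∑ a_k`, the sum being over `k < m J + K`, with
`a_k = 2 ^ (k p) ℒ {|quotient| ≥ 2 ^ k}`. Finiteness of the `L^{p,q}` quasinorm makes
`∑ a_k ^ (q / p)` converge; as `q < ∞`, `a_k → 0`, the Cesàro means of `a_k` tend to `0` too, and
`c = 0`. The second part follows since the right-hand side is finite for a bump function.
-/

open Set Metric Module
open scoped Topology

section DyadicLevels

variable {X : Type*} [MeasurableSpace X] {ν : Measure X} {G : X → ℝ≥0∞} {p : ℝ}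

/-- The `k`-th dyadic sample `2 ^ (k p) ν {G ≥ 2 ^ k}` of the `p`-th power of the
weak `L^p` quasinorm of `G`. -/
noncomputable def dyadicLevel (G : X → ℝ≥0∞) (p : ℝ) (ν : Measure X) (k : ℕ) : ℝ≥0∞ :=
  (2 ^ k) ^ p * ν {z | 2 ^ k ≤ G z}

theorem dyadicLevel_mono_ae {H : X → ℝ≥0∞} (h : ∀ᵐ z ∂ν, G z ≤ H z) (k : ℕ) :
    dyadicLevel G p ν k ≤ dyadicLevel H p ν k := by
  refine mul_le_mul_right (measure_mono_ae ?_) _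
  filter_upwards [h] with z hz hk using le_trans hk hz

theorem dyadicLevel_restrict_le (s : Set X) (k : ℕ) :
    dyadicLevel G p (ν.restrict s) k ≤ dyadicLevel G p ν k :=
  mul_le_mul_right (Measure.restrict_apply_le _ _) _

theorem dyadicLevel_ne_top [IsFiniteMeasure ν] (hp : 0 ≤ p) (k : ℕ) :
    dyadicLevel G p ν k ≠ ∞ :=
  ENNReal.mul_ne_top (ENNReal.rpow_ne_top_of_nonneg hp (by simp)) (measure_ne_top _ _)

theorem rpow_le_one_add_sum_dyadic (hp : 0 ≤ p) {K : ℕ} {x : ℝ≥0∞} (hx : x ≤ 2 ^ K) :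
    x ^ p ≤ 1 + 2 ^ p * ∑ k ∈ Finset.range K, (2 ^ k) ^ p * (Ici (2 ^ k)).indicator 1 x := by
  induction K with
  | zero => simpa using ENNReal.rpow_le_one (by simpa using hx) hp
  | succ K ih =>
    rw [Finset.sum_range_succ, mul_add, ← add_assoc]
    rcases le_total x (2 ^ K) with hK | hK
    · exact (ih hK).trans le_self_add
    · rw [indicator_of_mem (mem_Ici.2 hK), Pi.one_apply, mul_one,
        ← ENNReal.mul_rpow_of_nonneg _ _ hp, ← pow_succ']
      exact (ENNReal.rpow_le_rpow hx hp).trans le_add_self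

theorem lintegral_rpow_le_sum_dyadicLevel (hG : Measurable G) (hp : 0 ≤ p) {K : ℕ}
    (hK : ∀ᵐ z ∂ν, G z ≤ 2 ^ K) :
    ∫⁻ z, G z ^ p ∂ν ≤ ν univ + 2 ^ p * ∑ k ∈ Finset.range K, dyadicLevel G p ν k := by
  have hmeas (k : ℕ) :
      Measurable fun z => (Ici ((2 : ℝ≥0∞) ^ k)).indicator (1 : ℝ≥0∞ → ℝ≥0∞) (G z) :=
    (measurable_one.indicator measurableSet_Ici).comp hG
  have hlevel (k : ℕ) :
      ∫⁻ z, (2 ^ k) ^ p * (Ici (2 ^ k)).indicator 1 (G z) ∂ν = dyadicLevel G p ν k := by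
    rw [lintegral_const_mul _ (hmeas k)]
    exact congrArg _ (lintegral_indicator_one (hG measurableSet_Ici))
  calc ∫⁻ z, G z ^ p ∂ν
      ≤ ∫⁻ z, 1 + 2 ^ p * ∑ k ∈ Finset.range K,
          (2 ^ k) ^ p * (Ici (2 ^ k)).indicator 1 (G z) ∂ν :=
        lintegral_mono_ae (hK.mono fun z hz => rpow_le_one_add_sum_dyadic hp hz)
    _ = ν univ + 2 ^ p * ∑ k ∈ Finset.range K, dyadicLevel G p ν k := by
        rw [lintegral_add_left measurable_const, lintegral_const, one_mul,
          lintegral_const_mul _ (by fun_prop), lintegral_finsetSum _ (by fun_prop)]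
        simp only [hlevel]

theorem nonpos_of_forall_nat_mul_le_add_sum {a : ℕ → ℝ} (ha : Tendsto a atTop (𝓝 0))
    {c A B : ℝ} {m K : ℕ} (hm : m ≠ 0)
    (h : ∀ J : ℕ, J * c ≤ A + B * ∑ k ∈ Finset.range (m * J + K), a k) : c ≤ 0 := by
  have hindex : Tendsto (fun J : ℕ => m * J + K) atTop atTop :=
    tendsto_atTop_mono (fun J => (Nat.le_mul_of_pos_left J (Nat.pos_of_ne_zero hm)).trans
      (Nat.le_add_right _ K)) tendsto_id
  have hsum : Tendsto (fun J : ℕ => (∑ k ∈ Finset.range (m * J + K), a k) / (m * J + K : ℕ))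
      atTop (𝓝 0) :=
    (Asymptotics.isLittleO_sum_range_of_tendsto_zero ha).tendsto_div_nhds_zero.comp hindex
  have hratio : Tendsto (fun J : ℕ => ((m * J + K : ℕ) : ℝ) / J) atTop (𝓝 (m + 0)) := by
    refine ((tendsto_const_div_atTop_nhds_zero_nat (K : ℝ)).const_add (m : ℝ)).congr' ?_
    filter_upwards [eventually_ne_atTop 0] with J hJ
    push_cast
    field_simp
  have hlim : Tendsto (fun J : ℕ => A / J + B *
      ((∑ k ∈ Finset.range (m * J + K), a k) / (m * J + K : ℕ) * ((m * J + K : ℕ) / J)))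
      atTop (𝓝 0) := by
    simpa using (tendsto_const_div_atTop_nhds_zero_nat A).add ((hsum.mul hratio).const_mul B)
  refine ge_of_tendsto hlim ?_
  filter_upwards [eventually_gt_atTop 0] with J hJ
  have hJ' : (0 : ℝ) < J := Nat.cast_pos.2 hJ
  have hN : ((m * J + K : ℕ) : ℝ) ≠ 0 := by positivity
  rw [div_mul_div_cancel₀ hN, mul_div_assoc', ← add_div, le_div_iff₀ hJ', mul_comm]
  exact h J

section

variable {S : ℕ → Set X} {m K : ℕ} {c : ℝ≥0∞}

theorem natCast_mul_le_add_sum_dyadicLevel (hG : Measurable G) (hp : 0 ≤ p)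
    (hS : ∀ j, MeasurableSet (S j)) (hdisj : Pairwise (Function.onFun Disjoint S))
    (hle : ∀ j, ∀ z ∈ S j, G z ≤ 2 ^ (m * j + K)) (hc : ∀ j, c ≤ ∫⁻ z in S j, G z ^ p ∂ν)
    (J : ℕ) :
    J * c ≤ ν univ + 2 ^ p * ∑ k ∈ Finset.range (m * J + K), dyadicLevel G p ν k := by
  set T := ⋃ j ∈ Finset.range J, S j
  have hT : MeasurableSet T := Finset.measurableSet_biUnion _ fun j _ => hS j
  have hleT : ∀ z ∈ T, G z ≤ 2 ^ (m * J + K) := by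
    intro z hz
    obtain ⟨j, hj, hzj⟩ := mem_iUnion₂.1 hz
    have hjJ : j ≤ J := (Finset.mem_range.1 hj).le
    exact (hle j z hzj).trans (pow_le_pow_right₀ one_le_two (by gcongr))
  calc (J : ℝ≥0∞) * c = ∑ _j ∈ Finset.range J, c := by simp
    _ ≤ ∑ j ∈ Finset.range J, ∫⁻ z in S j, G z ^ p ∂ν := Finset.sum_le_sum fun j _ => hc j
    _ = ∫⁻ z in T, G z ^ p ∂ν :=
      (lintegral_biUnion_finset (fun i _ j _ hij => hdisj hij) (fun j _ => hS j) _).symm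
    _ ≤ ν.restrict T univ +
        2 ^ p * ∑ k ∈ Finset.range (m * J + K), dyadicLevel G p (ν.restrict T) k :=
      lintegral_rpow_le_sum_dyadicLevel hG hp (ae_restrict_of_forall_mem hT hleT)
    _ ≤ ν univ + 2 ^ p * ∑ k ∈ Finset.range (m * J + K), dyadicLevel G p ν k := by
      gcongr with k
      · exact Measure.restrict_le_self
      · exact dyadicLevel_restrict_le T k

theorem eq_zero_of_forall_le_setLIntegral_rpow [IsFiniteMeasure ν] (hG : Measurable G)
    (hp : 0 ≤ p) (hlim : Tendsto (dyadicLevel G p ν) atTop (𝓝 0))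
    (hS : ∀ j, MeasurableSet (S j)) (hdisj : Pairwise (Function.onFun Disjoint S)) (hm : m ≠ 0)
    (hle : ∀ j, ∀ z ∈ S j, G z ≤ 2 ^ (m * j + K))
    (hc : ∀ j, c ≤ ∫⁻ z in S j, G z ^ p ∂ν) : c = 0 := by
  have key := natCast_mul_le_add_sum_dyadicLevel hG hp hS hdisj hle hc
  have hpow : (2 : ℝ≥0∞) ^ p ≠ ∞ := ENNReal.rpow_ne_top_of_nonneg hp (by simp)
  have hsum (n : ℕ) : 2 ^ p * ∑ k ∈ Finset.range n, dyadicLevel G p ν k ≠ ∞ :=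
    ENNReal.mul_ne_top hpow (ENNReal.sum_ne_top.2 fun k _ => dyadicLevel_ne_top hp k)
  have hbound (n : ℕ) : ν univ + 2 ^ p * ∑ k ∈ Finset.range n, dyadicLevel G p ν k ≠ ∞ :=
    ENNReal.add_ne_top.2 ⟨measure_ne_top _ _, hsum n⟩
  have hc_top : c ≠ ∞ := ne_top_of_le_ne_top (hbound (m * 1 + K)) (by simpa using key 1)
  have hreal (J : ℕ) : J * c.toReal ≤ (ν univ).toReal + ((2 : ℝ≥0∞) ^ p).toReal *
      ∑ k ∈ Finset.range (m * J + K), (dyadicLevel G p ν k).toReal := by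
    have h := ENNReal.toReal_mono (hbound _) (key J)
    rwa [ENNReal.toReal_add (measure_ne_top _ _) (hsum _), ENNReal.toReal_mul,
      ENNReal.toReal_natCast, ENNReal.toReal_mul,
      ENNReal.toReal_sum fun k _ => dyadicLevel_ne_top hp k] at h
  have hnonpos : c.toReal ≤ 0 := nonpos_of_forall_nat_mul_le_add_sum
    ((ENNReal.tendsto_toReal ENNReal.zero_ne_top).comp hlim) hm hreal
  exact ((ENNReal.toReal_eq_zero_iff c).1 (hnonpos.antisymm ENNReal.toReal_nonneg)).resolve_right
    hc_top

end

end DyadicLevels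

section Lorentz

theorem lorentzQuasinorm_congr_abs {α : Type*} [MeasurableSpace α] {μ : Measure α} {f g : α → ℝ}
    (h : ∀ z, |f z| = |g z|) (p q : ℝ) : lorentzQuasinorm f p q μ = lorentzQuasinorm g p q μ := by
  simp only [lorentzQuasinorm, h]

theorem rpow_mul_le_setLIntegral_Ioc {φ : ℝ → ℝ≥0∞} (hφ : Antitone φ) {q : ℝ} (hq : 0 ≤ q)
    {b : ℝ} (hb : 0 < b) :
    ENNReal.ofReal b ^ q * φ b ≤ 2 ^ (q + 1) *
      ∫⁻ t in Ioc (b / 2) b, ENNReal.ofReal t ^ q * φ t / ENNReal.ofReal t := by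
  have hb0 : ENNReal.ofReal b ≠ 0 := by simpa using hb
  have hhalf : ENNReal.ofReal (b / 2) = ENNReal.ofReal b / 2 := by
    rw [ENNReal.ofReal_div_of_pos two_pos, ENNReal.ofReal_ofNat]
  have h2 : (2 : ℝ≥0∞) ^ (q + 1) = 2 ^ q * 2 := by
    rw [ENNReal.rpow_add_of_nonneg _ _ hq zero_le_one, ENNReal.rpow_one]
  have h2q : (2 : ℝ≥0∞) ^ q ≠ 0 := by simp
  have h2q' : (2 : ℝ≥0∞) ^ q ≠ ∞ := ENNReal.rpow_ne_top_of_nonneg hq (by simp)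
  calc ENNReal.ofReal b ^ q * φ b
      = 2 ^ (q + 1) * (ENNReal.ofReal (b / 2) ^ q * φ b / ENNReal.ofReal b *
          volume (Ioc (b / 2) b)) := by
        rw [Real.volume_Ioc, sub_half, hhalf, ENNReal.div_rpow_of_nonneg _ _ hq, h2]
        simp only [div_eq_mul_inv]
        calc ENNReal.ofReal b ^ q * φ b
            = ENNReal.ofReal b ^ q * φ b * (2 ^ q * (2 ^ q)⁻¹) * (2 * 2⁻¹) *
              (ENNReal.ofReal b * (ENNReal.ofReal b)⁻¹) := by
              rw [ENNReal.mul_inv_cancel h2q h2q', ENNReal.mul_inv_cancel two_ne_zero (by simp),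
                ENNReal.mul_inv_cancel hb0 ENNReal.ofReal_ne_top]
              simp only [mul_one]
          _ = _ := by ring
    _ = 2 ^ (q + 1) * ∫⁻ _ in Ioc (b / 2) b,
          ENNReal.ofReal (b / 2) ^ q * φ b / ENNReal.ofReal b := by rw [setLIntegral_const]
    _ ≤ 2 ^ (q + 1) * ∫⁻ t in Ioc (b / 2) b,
          ENNReal.ofReal t ^ q * φ t / ENNReal.ofReal t := by
        gcongr 2 ^ (q + 1) * ?_
        refine setLIntegral_mono' measurableSet_Ioc fun t ht => ?_
        gcongr
        exacts [ht.1.le, hφ ht.2, ht.2]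

theorem tsum_dyadic_le_lintegral_Ioi {φ : ℝ → ℝ≥0∞} (hφ : Antitone φ) {q : ℝ} (hq : 0 ≤ q) :
    ∑' k : ℕ, (2 ^ k) ^ q * φ (2 ^ k) ≤ 2 ^ (q + 1) *
      ∫⁻ t in Ioi (0 : ℝ), ENNReal.ofReal t ^ q * φ t / ENNReal.ofReal t := by
  have hdisj : Pairwise (Function.onFun Disjoint fun k : ℕ => Ioc ((2 : ℝ) ^ k / 2) (2 ^ k)) := by
    have hmono : Monotone fun k : ℕ => (2 : ℝ) ^ k / 2 := fun i j hij => by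
      dsimp only
      gcongr
      exact one_le_two
    simpa only [Nat.succ_eq_succ, Nat.succ_eq_add_one, pow_succ,
      mul_div_cancel_right₀ _ (two_ne_zero' ℝ)] using hmono.pairwise_disjoint_on_Ioc_succ
  have hpos : ⋃ k : ℕ, Ioc ((2 : ℝ) ^ k / 2) (2 ^ k) ⊆ Ioi 0 :=
    iUnion_subset fun k t ht => lt_trans (by positivity) ht.1
  calc ∑' k : ℕ, (2 ^ k) ^ q * φ (2 ^ k)
      ≤ ∑' k : ℕ, 2 ^ (q + 1) * ∫⁻ t in Ioc ((2 : ℝ) ^ k / 2) (2 ^ k),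
          ENNReal.ofReal t ^ q * φ t / ENNReal.ofReal t := by
        refine ENNReal.tsum_le_tsum fun k => ?_
        have h := rpow_mul_le_setLIntegral_Ioc hφ hq (pow_pos two_pos k)
        rwa [ENNReal.ofReal_pow two_pos.le, ENNReal.ofReal_ofNat] at h
    _ = 2 ^ (q + 1) * ∫⁻ t in ⋃ k : ℕ, Ioc ((2 : ℝ) ^ k / 2) (2 ^ k),
          ENNReal.ofReal t ^ q * φ t / ENNReal.ofReal t := by
        rw [ENNReal.tsum_mul_left, lintegral_iUnion (fun _ => measurableSet_Ioc) hdisj]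
    _ ≤ _ := mul_le_mul_right (lintegral_mono_set hpos) _

theorem tendsto_dyadicLevel_of_lorentzQuasinorm_lt_top {α : Type*} [MeasurableSpace α]
    {μ : Measure α} {f : α → ℝ} {p q : ℝ} (hp : 0 < p) (hq : 0 < q)
    (h : lorentzQuasinorm f p q μ < ∞) :
    Tendsto (dyadicLevel (fun z => ‖f z‖ₑ) p μ) atTop (𝓝 0) := by
  set φ : ℝ → ℝ≥0∞ := fun t => μ {z | t ≤ |f z|} ^ (q / p) with hφ_def
  have hφ : Antitone φ := fun s t hst =>
    ENNReal.rpow_le_rpow (measure_mono fun z hz => hst.trans hz) (by positivity)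
  have hint : ∫⁻ t in Ioi (0 : ℝ), ENNReal.ofReal t ^ q * φ t / ENNReal.ofReal t ≠ ∞ := by
    rw [lorentzQuasinorm, ENNReal.rpow_lt_top_iff_of_pos (by positivity)] at h
    exact (ENNReal.lt_top_of_mul_ne_top_right h.ne (by simpa using hp)).ne
  have hlevel (k : ℕ) :
      ((2 ^ k) ^ q * φ (2 ^ k)) ^ (p / q) = dyadicLevel (fun z => ‖f z‖ₑ) p μ k := by
    have hset : {z | (2 : ℝ) ^ k ≤ |f z|} = {z | 2 ^ k ≤ ‖f z‖ₑ} := by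
      ext z
      rw [mem_ofPred_eq, mem_ofPred_eq, Real.enorm_eq_ofReal_abs, ← ENNReal.ofReal_ofNat,
        ← ENNReal.ofReal_pow two_pos.le, ENNReal.ofReal_le_ofReal_iff (abs_nonneg _)]
    rw [dyadicLevel, ← hset, hφ_def, ENNReal.mul_rpow_of_nonneg _ _ (by positivity),
      ← ENNReal.rpow_mul, ← ENNReal.rpow_mul, mul_div_cancel₀ _ hq.ne',
      div_mul_div_cancel₀ hp.ne', div_self hq.ne', ENNReal.rpow_one]
  have hsum : ∑' k : ℕ, (2 ^ k) ^ q * φ (2 ^ k) ≠ ∞ :=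
    ne_top_of_le_ne_top (ENNReal.mul_ne_top (ENNReal.rpow_ne_top_of_nonneg (by positivity)
      (by simp)) hint) (tsum_dyadic_le_lintegral_Ioi hφ hq.le)
  have hzero := (ENNReal.tendsto_atTop_zero_of_tsum_ne_top hsum).ennrpow_const (p / q)
  rw [ENNReal.zero_rpow_of_pos (by positivity)] at hzero
  exact hzero.congr hlevel

end Lorentz

section DyadicShell

variable {E : Type*} [NormedAddCommGroup E]

variable (E) in
/-- The shell `ρ / 2 < ‖w‖ ≤ ρ` around the origin. -/
def dyadicShell (ρ : ℝ) : Set E := closedBall 0 ρ \ closedBall 0 (ρ / 2)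

theorem mem_dyadicShell {ρ : ℝ} {w : E} : w ∈ dyadicShell E ρ ↔ ‖w‖ ≤ ρ ∧ ρ / 2 < ‖w‖ := by
  simp [dyadicShell]

theorem measurableSet_dyadicShell [MeasurableSpace E] [OpensMeasurableSpace E] (ρ : ℝ) :
    MeasurableSet (dyadicShell E ρ) :=
  measurableSet_closedBall.diff measurableSet_closedBall

theorem dyadicShell_div_two_pow_subset_closedBall {ρ : ℝ} (hρ : 0 ≤ ρ) (j : ℕ) :
    dyadicShell E (ρ / 2 ^ j) ⊆ closedBall 0 ρ :=
  sdiff_subset.trans (closedBall_subset_closedBall (div_le_self hρ (one_le_pow₀ one_le_two)))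

variable (E) in
theorem pairwise_disjoint_dyadicShell {ρ : ℝ} (hρ : 0 ≤ ρ) :
    Pairwise (Function.onFun Disjoint fun j : ℕ => dyadicShell E (ρ / 2 ^ j)) := by
  refine (pairwise_disjoint_on _).2 fun i j hij => ?_
  refine disjoint_left.2 fun w hi hj => hi.2 (closedBall_subset_closedBall ?_ hj.1)
  rw [div_div, ← pow_succ]
  gcongr
  exacts [one_le_two, hij]

theorem exists_mem_dyadicShell_two_zpow {w : E} (hw : w ≠ 0) :
    ∃ s : ℤ, w ∈ dyadicShell E (2 ^ s) := by
  obtain ⟨s, hs, hs'⟩ := exists_mem_Ioc_zpow (norm_pos_iff.2 hw) (one_lt_two : (1 : ℝ) < 2)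
  refine ⟨s + 1, mem_dyadicShell.2 ⟨hs', ?_⟩⟩
  rwa [zpow_add_one₀ two_ne_zero, mul_div_cancel_right₀ _ two_ne_zero]

theorem two_smul_mem_dyadicShell_iff [NormedSpace ℝ E] {ρ : ℝ} {w : E} :
    (2 : ℝ) • w ∈ dyadicShell E ρ ↔ w ∈ dyadicShell E (ρ / 2) := by
  rw [mem_dyadicShell, mem_dyadicShell, norm_smul, Real.norm_ofNat, le_div_iff₀' two_pos]
  exact and_congr_right' (div_lt_iff₀' two_pos).symm

theorem setLIntegral_dyadicShell_eq [NormedSpace ℝ E] [FiniteDimensional ℝ E]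
    [MeasurableSpace E] [BorelSpace E] (μ : Measure E) [μ.IsAddHaarMeasure] (f : E → ℝ≥0∞)
    (ρ : ℝ) :
    ∫⁻ w in dyadicShell E ρ, f w ∂μ =
      2 ^ finrank ℝ E * ∫⁻ w in dyadicShell E (ρ / 2), f ((2 : ℝ) • w) ∂μ := by
  let e : E ≃ᵐ E := (Homeomorph.smulOfNeZero (2 : ℝ) two_ne_zero).toMeasurableEquiv
  have hmap : μ.map e = (2 ^ finrank ℝ E : ℝ≥0∞)⁻¹ • μ := by
    refine (Measure.map_addHaar_smul μ two_ne_zero).trans ?_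
    rw [abs_of_pos (by positivity), ENNReal.ofReal_inv_of_pos (by positivity),
      ENNReal.ofReal_pow two_pos.le, ENNReal.ofReal_ofNat]
  have hpre : e ⁻¹' dyadicShell E ρ = dyadicShell E (ρ / 2) :=
    Set.ext fun _ => two_smul_mem_dyadicShell_iff
  have h : ∫⁻ w in dyadicShell E (ρ / 2), f ((2 : ℝ) • w) ∂μ =
      (2 ^ finrank ℝ E)⁻¹ * ∫⁻ w in dyadicShell E ρ, f w ∂μ := by
    rw [← hpre, ← smul_eq_mul, ← lintegral_smul_measure, ← Measure.restrict_smul, ← hmap,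
      e.restrict_map, lintegral_map_equiv]
    rfl
  rw [h, ← mul_assoc, ENNReal.mul_inv_cancel (by simp) (by simp), one_mul]

end DyadicShell

section ShiftedQuotient

variable {E : Type*} [NormedAddCommGroup E] {d : E → E → ℝ≥0∞} {p : ℝ}

theorem setLIntegral_ball_comp_add_left_le [MeasurableSpace E] [BorelSpace E] {μ : Measure E}
    [μ.IsAddLeftInvariant] (f : E → ℝ≥0∞) (w : E) (r : ℝ) :
    ∫⁻ y in ball 0 r, f (w + y) ∂μ ≤ ∫⁻ y in ball 0 (r + ‖w‖), f y ∂μ := by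
  rw [← lintegral_indicator measurableSet_ball, ← lintegral_indicator measurableSet_ball,
    ← lintegral_add_left_eq_self ((ball 0 (r + ‖w‖)).indicator f) w]
  refine lintegral_mono (indicator_le fun y hy => ?_)
  have hwy : w + y ∈ ball (0 : E) (r + ‖w‖) := by
    rw [mem_ball_zero_iff] at hy ⊢
    linarith [norm_add_le w y]
  rw [indicator_of_mem hwy]

theorem setLIntegral_ball_rpow_add_self_le [MeasurableSpace E] [BorelSpace E]
    {μ : Measure E} [μ.IsAddLeftInvariant] (hd : Measurable (Function.uncurry d))
    (htri : ∀ x y z, d x z ≤ d x y + d y z) (hp : 1 ≤ p) (w : E) (r : ℝ) :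
    ∫⁻ y in ball 0 r, d (w + w + y) y ^ p ∂μ ≤
      2 ^ p * ∫⁻ y in ball 0 (r + ‖w‖), d (w + y) y ^ p ∂μ := by
  set f : E → ℝ≥0∞ := fun y => d (w + y) y ^ p
  have hf : Measurable f := by
    have : Measurable fun y => d (w + y) y :=
      hd.comp ((measurable_const_add w).prodMk measurable_id)
    fun_prop
  have hdouble (y : E) : d (w + w + y) y ^ p ≤ 2 ^ (p - 1) * (f (w + y) + f y) := by
    rw [add_assoc]
    exact (ENNReal.rpow_le_rpow (htri _ (w + y) _) (by linarith)).trans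
      (ENNReal.rpow_add_le_mul_rpow_add_rpow _ _ hp)
  calc ∫⁻ y in ball 0 r, d (w + w + y) y ^ p ∂μ
      ≤ ∫⁻ y in ball 0 r, 2 ^ (p - 1) * (f (w + y) + f y) ∂μ := lintegral_mono hdouble
    _ = 2 ^ (p - 1) * (∫⁻ y in ball 0 r, f (w + y) ∂μ + ∫⁻ y in ball 0 r, f y ∂μ) := by
        rw [lintegral_const_mul _ (by fun_prop), lintegral_add_right _ hf]
    _ ≤ 2 ^ (p - 1) * (∫⁻ y in ball 0 (r + ‖w‖), f y ∂μ + ∫⁻ y in ball 0 (r + ‖w‖), f y ∂μ) := by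
        gcongr 2 ^ (p - 1) * (?_ + ?_)
        · exact setLIntegral_ball_comp_add_left_le f w r
        · exact lintegral_mono_set (ball_subset_ball (le_add_of_nonneg_right (norm_nonneg w)))
    _ = 2 ^ p * ∫⁻ y in ball 0 (r + ‖w‖), f y ∂μ := by
        rw [← two_mul, ← mul_assoc, ENNReal.rpow_sub _ _ two_ne_zero (by simp), ENNReal.rpow_one,
          ENNReal.div_mul_cancel two_ne_zero (by simp)]

variable [NormedSpace ℝ E]

/-- The difference quotient `d x y / |x - y| ^ (dim E / p + 1)` of a kernel `d`, in the
coordinates `z = (x - y, y)`. -/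
noncomputable def shiftedQuotient (d : E → E → ℝ≥0∞) (p : ℝ) (z : E × E) : ℝ≥0∞ :=
  d (z.1 + z.2) z.2 / ‖z.1‖ₑ ^ ((finrank ℝ E : ℝ) / p + 1)

theorem shiftedQuotient_rpow (hp : 0 < p) (z : E × E) :
    shiftedQuotient d p z ^ p =
      d (z.1 + z.2) z.2 ^ p / ‖z.1‖ₑ ^ ((finrank ℝ E : ℝ) + p) := by
  rw [shiftedQuotient, ENNReal.div_rpow_of_nonneg _ _ hp.le, ← ENNReal.rpow_mul]
  congr 2
  field_simp

theorem exists_shiftedQuotient_le_two_pow (hd_le : ∀ x y, d x y ≤ 1) (hp : 0 ≤ p) {ρ : ℝ}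
    (hρ : 0 < ρ) :
    ∃ m K : ℕ, m ≠ 0 ∧ ∀ j : ℕ, ∀ z : E × E, z.1 ∈ dyadicShell E (ρ / 2 ^ j) →
      shiftedQuotient d p z ≤ 2 ^ (m * j + K) := by
  set γ : ℝ := (finrank ℝ E : ℝ) / p + 1
  have hγ : 0 < γ := by positivity
  obtain ⟨m, hm⟩ := exists_nat_ge γ
  obtain ⟨K, hK⟩ := exists_pow_lt_of_lt_one (half_pos hρ) (one_half_lt_one (α := ℝ))
  refine ⟨m, m * K, fun h => hγ.not_ge (by simpa [h] using hm), fun j z hz => ?_⟩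
  have hnorm : (1 / 2) ^ (j + K) ≤ ‖z.1‖ := by
    refine le_trans ?_ (mem_dyadicShell.1 hz).2.le
    rw [pow_add, div_right_comm, div_eq_mul_one_div (ρ / 2), ← one_div_pow, mul_comm]
    gcongr
  have hinv : ‖z.1‖ₑ⁻¹ ≤ 2 ^ (j + K) := by
    have h := ENNReal.ofReal_le_ofReal hnorm
    rw [ofReal_norm, ENNReal.ofReal_pow (by positivity), one_div,
      ENNReal.ofReal_inv_of_pos two_pos, ENNReal.ofReal_ofNat, ENNReal.inv_pow.symm] at h
    exact ENNReal.inv_le_iff_inv_le.1 h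
  calc shiftedQuotient d p z ≤ 1 / ‖z.1‖ₑ ^ γ := ENNReal.div_le_div_right (hd_le _ _) _
    _ = (‖z.1‖ₑ⁻¹) ^ γ := by rw [one_div, ENNReal.inv_rpow]
    _ ≤ (2 ^ (j + K)) ^ (m : ℝ) := (ENNReal.rpow_le_rpow hinv hγ.le).trans
      (ENNReal.rpow_le_rpow_of_exponent_le (one_le_pow₀ one_le_two) hm)
    _ = 2 ^ (m * j + m * K) := by rw [ENNReal.rpow_natCast, ← pow_mul, ← mul_add, mul_comm]

variable [MeasurableSpace E] [BorelSpace E]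

theorem measurable_shiftedQuotient [SecondCountableTopology E]
    (hd : Measurable (Function.uncurry d)) (p : ℝ) : Measurable (shiftedQuotient d p) := by
  have : Measurable fun z : E × E => d (z.1 + z.2) z.2 :=
    hd.comp (measurable_add.prodMk measurable_snd)
  unfold shiftedQuotient
  fun_prop

variable [FiniteDimensional ℝ E] {μ : Measure E}

/-- The integral of `shiftedQuotient d p ^ p` over `ρ / 2 < |x - y| ≤ ρ`, `|y| < r`: the part at
scale `ρ` of the (divergent) Gagliardo energy of smoothness one. -/
noncomputable def shellEnergy (d : E → E → ℝ≥0∞) (p : ℝ) (μ : Measure E) (ρ r : ℝ) : ℝ≥0∞ :=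
  ∫⁻ z in dyadicShell E ρ ×ˢ ball 0 r, shiftedQuotient d p z ^ p ∂μ.prod μ

theorem ae_shift_eq_zero_of_shellEnergy_eq_zero (hd : Measurable (Function.uncurry d))
    (hd_self : ∀ x, d x x = 0) (hp : 0 < p)
    (h : ∀ ρ > 0, ∀ r, shellEnergy d p μ ρ r = 0) :
    ∀ᵐ z ∂μ.prod μ, d (z.1 + z.2) z.2 = 0 := by
  have hquot := measurable_shiftedQuotient hd p
  have hshell (s : ℤ) (r : ℕ) : ∀ᵐ z ∂μ.prod μ,
      z ∈ dyadicShell E (2 ^ s) ×ˢ ball (0 : E) r → d (z.1 + z.2) z.2 = 0 := by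
    have hzero := h (2 ^ s) (by positivity) r
    rw [shellEnergy, setLIntegral_eq_zero_iff
      ((measurableSet_dyadicShell _).prod measurableSet_ball) (by fun_prop)] at hzero
    filter_upwards [hzero] with z hz hmem
    have hz0 := (ENNReal.rpow_eq_zero_iff_of_pos hp).1 (hz hmem)
    exact (ENNReal.div_eq_zero_iff.1 hz0).resolve_right
      (ENNReal.rpow_ne_top_of_nonneg (by positivity) enorm_ne_top)
  filter_upwards [ae_all_iff.2 fun s => ae_all_iff.2 (hshell s)] with z hz
  rcases eq_or_ne z.1 0 with h0 | h0
  · simp [h0, hd_self]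
  · obtain ⟨s, hs⟩ := exists_mem_dyadicShell_two_zpow h0
    obtain ⟨r, hr⟩ := exists_nat_gt ‖z.2‖
    exact hz s r ⟨hs, mem_ball_zero_iff.2 hr⟩

variable [μ.IsAddHaarMeasure]

theorem shellEnergy_eq_lintegral (hd : Measurable (Function.uncurry d)) (hp : 0 < p) (ρ r : ℝ) :
    shellEnergy d p μ ρ r = ∫⁻ w in dyadicShell E ρ,
      (∫⁻ y in ball 0 r, d (w + y) y ^ p ∂μ) / ‖w‖ₑ ^ ((finrank ℝ E : ℝ) + p) ∂μ := by
  have hdw (w : E) : Measurable fun y => d (w + y) y :=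
    hd.comp ((measurable_const_add w).prodMk measurable_id)
  have hquot := measurable_shiftedQuotient hd p
  rw [shellEnergy, setLIntegral_prod _ (by fun_prop)]
  simp only [shiftedQuotient_rpow hp, div_eq_mul_inv]
  refine lintegral_congr fun w => ?_
  exact lintegral_mul_const _ ((hdw w).pow_const p)

theorem shellEnergy_le_shellEnergy_half (hd : Measurable (Function.uncurry d))
    (htri : ∀ x y z, d x z ≤ d x y + d y z) (hp : 1 ≤ p) (ρ r : ℝ) :
    shellEnergy d p μ ρ r ≤ shellEnergy d p μ (ρ / 2) (r + ρ / 2) := by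
  have hp0 : 0 < p := by linarith
  set s : ℝ := (finrank ℝ E : ℝ) + p with hs
  have hs0 : 0 ≤ s := by positivity
  have h2s : (2 : ℝ≥0∞) ^ s ≠ ∞ := ENNReal.rpow_ne_top_of_nonneg hs0 (by simp)
  have hscale (w : E) : ‖(2 : ℝ) • w‖ₑ ^ s = 2 ^ s * ‖w‖ₑ ^ s := by
    rw [enorm_smul, Real.enorm_eq_ofReal_abs, abs_two, ENNReal.ofReal_ofNat,
      ENNReal.mul_rpow_of_nonneg _ _ hs0]
  have hpow : (2 : ℝ≥0∞) ^ finrank ℝ E * 2 ^ p = 2 ^ s := by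
    rw [hs, ENNReal.rpow_add_of_nonneg _ _ (Nat.cast_nonneg _) hp0.le, ENNReal.rpow_natCast]
  rw [shellEnergy_eq_lintegral hd hp0, shellEnergy_eq_lintegral hd hp0,
    setLIntegral_dyadicShell_eq, ← lintegral_const_mul' _ _ (by simp)]
  refine setLIntegral_mono' (measurableSet_dyadicShell _) fun w hw => ?_
  have hw' : r + ‖w‖ ≤ r + ρ / 2 := add_le_add_right (mem_dyadicShell.1 hw).1 r
  calc 2 ^ finrank ℝ E *
        ((∫⁻ y in ball 0 r, d ((2 : ℝ) • w + y) y ^ p ∂μ) / ‖(2 : ℝ) • w‖ₑ ^ s)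
      ≤ 2 ^ finrank ℝ E * ((2 ^ p * ∫⁻ y in ball 0 (r + ρ / 2), d (w + y) y ^ p ∂μ) /
          (2 ^ s * ‖w‖ₑ ^ s)) := by
        rw [hscale, two_smul]
        gcongr
        exact (setLIntegral_ball_rpow_add_self_le hd htri hp w r).trans
          (mul_le_mul_right (lintegral_mono_set (ball_subset_ball hw')) _)
    _ = (∫⁻ y in ball 0 (r + ρ / 2), d (w + y) y ^ p ∂μ) / ‖w‖ₑ ^ s := by
        rw [← mul_div_assoc, ← mul_assoc, hpow, ENNReal.mul_div_mul_left _ _ (by simp) h2s]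

theorem shellEnergy_le_shellEnergy_div_two_pow (hd : Measurable (Function.uncurry d))
    (htri : ∀ x y z, d x z ≤ d x y + d y z) (hp : 1 ≤ p) (j : ℕ) (ρ r : ℝ) :
    shellEnergy d p μ ρ r ≤ shellEnergy d p μ (ρ / 2 ^ j) (r + ρ * (1 - 1 / 2 ^ j)) := by
  induction j generalizing ρ r with
  | zero => simp
  | succ j ih =>
    refine (shellEnergy_le_shellEnergy_half hd htri hp ρ r).trans ((ih _ _).trans_eq ?_)
    congr 1 <;> field_simp <;> ring

theorem shellEnergy_eq_zero_of_tendsto_dyadicLevel (hd : Measurable (Function.uncurry d))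
    (htri : ∀ x y z, d x z ≤ d x y + d y z) (hd_le : ∀ x y, d x y ≤ 1) (hp : 1 ≤ p)
    (hlim : Tendsto (dyadicLevel (shiftedQuotient d p) p (μ.prod μ)) atTop (𝓝 0)) {ρ : ℝ}
    (hρ : 0 < ρ) (r : ℝ) : shellEnergy d p μ ρ r = 0 := by
  set S : ℕ → Set (E × E) := fun j => dyadicShell E (ρ / 2 ^ j) ×ˢ ball 0 (r + ρ)
  set T : Set (E × E) := closedBall 0 ρ ×ˢ ball 0 (r + ρ)
  have hST (j : ℕ) : S j ⊆ T :=
    prod_mono_left (dyadicShell_div_two_pow_subset_closedBall hρ.le j)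
  have hT : IsFiniteMeasure ((μ.prod μ).restrict T) := by
    refine isFiniteMeasure_restrict.2 ?_
    rw [Measure.prod_prod]
    exact ENNReal.mul_ne_top measure_closedBall_lt_top.ne measure_ball_lt_top.ne
  have hlimT : Tendsto (dyadicLevel (shiftedQuotient d p) p ((μ.prod μ).restrict T)) atTop (𝓝 0) :=
    tendsto_of_tendsto_of_tendsto_of_le_of_le tendsto_const_nhds hlim (fun _ => zero_le)
      (dyadicLevel_restrict_le T)
  have hdisj : Pairwise (Function.onFun Disjoint S) := fun i j hij =>
    (pairwise_disjoint_dyadicShell E hρ.le hij).set_prod_left _ _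
  have henergy (j : ℕ) : shellEnergy d p μ ρ r ≤
      ∫⁻ z in S j, shiftedQuotient d p z ^ p ∂(μ.prod μ).restrict T := by
    rw [Measure.restrict_restrict_of_subset (hST j)]
    refine (shellEnergy_le_shellEnergy_div_two_pow hd htri hp j ρ r).trans
      (lintegral_mono_set (prod_mono_right (ball_subset_ball ?_)))
    gcongr
    exact mul_le_of_le_one_right hρ.le (sub_le_self _ (by positivity))
  obtain ⟨m, K, hm, hle⟩ := exists_shiftedQuotient_le_two_pow hd_le (zero_le_one.trans hp) hρ
  exact eq_zero_of_forall_le_setLIntegral_rpow (measurable_shiftedQuotient hd p)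
    (zero_le_one.trans hp) hlimT
    (fun j => (measurableSet_dyadicShell _).prod measurableSet_ball) hdisj hm
    (fun j z hz => hle j z hz.1) henergy

end ShiftedQuotient

theorem min_one_edist_triangle {F : Type*} [PseudoEMetricSpace F] (a b c : F) :
    min 1 (edist a c) ≤ min 1 (edist a b) + min 1 (edist b c) := by
  rcases le_total 1 (edist a b) with hab | hab
  · exact (min_le_left _ _).trans (by rw [min_eq_left hab]; exact le_self_add)
  rcases le_total 1 (edist b c) with hbc | hbc
  · exact (min_le_left _ _).trans (by rw [min_eq_left hbc]; exact le_add_self)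
  rw [min_eq_right hab, min_eq_right hbc]
  exact (min_le_right _ _).trans (edist_triangle a b c)

section Rigidity

variable {E F : Type*} [NormedAddCommGroup E] [NormedSpace ℝ E] {p q : ℝ}

/-- The difference quotient `|u x - u y| / |x - y| ^ (dim E / p + 1)` of a map into a metric
space, which has the absolute value of `diffQuotient` as the case of `ℝ^N` and `ℝ`. -/
noncomputable def distQuotient [Dist F] (p : ℝ) (u : E → F) (z : E × E) : ℝ :=
  dist (u z.1) (u z.2) / ‖z.1 - z.2‖ ^ ((finrank ℝ E : ℝ) / p + 1)

theorem edist_div_le_enorm_distQuotient [PseudoMetricSpace F] (p : ℝ) (u : E → F) (z : E × E) :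
    edist (u z.1) (u z.2) / ‖z.1 - z.2‖ₑ ^ ((finrank ℝ E : ℝ) / p + 1) ≤ ‖distQuotient p u z‖ₑ := by
  rcases eq_or_ne z.1 z.2 with h | h
  · simp [h]
  · have hnorm : 0 < ‖z.1 - z.2‖ := norm_sub_pos_iff.2 h
    rw [distQuotient, Real.enorm_of_nonneg (by positivity), edist_dist,
      ENNReal.ofReal_div_of_pos (by positivity), ← ENNReal.ofReal_rpow_of_pos hnorm, ofReal_norm]

theorem abs_distQuotient {N : ℕ} (p : ℝ) (u : EuclideanSpace ℝ (Fin N) → ℝ)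
    (z : EuclideanSpace ℝ (Fin N) × EuclideanSpace ℝ (Fin N)) :
    |distQuotient p u z| = |diffQuotient p u z| := by
  rw [distQuotient, diffQuotient, finrank_euclideanSpace_fin, Real.dist_eq, abs_div, abs_div,
    abs_abs]

variable [MeasurableSpace E] [BorelSpace E] [FiniteDimensional ℝ E] {μ : Measure E}
  [μ.IsAddHaarMeasure]

theorem ae_prod_eq_zero_of_tendsto_dyadicLevel {d : E → E → ℝ≥0∞}
    (hd : Measurable (Function.uncurry d)) (hd_self : ∀ x, d x x = 0)
    (htri : ∀ x y z, d x z ≤ d x y + d y z) (hd_le : ∀ x y, d x y ≤ 1) (hp : 1 ≤ p)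
    (hlim : Tendsto (dyadicLevel
      (fun z : E × E => d z.1 z.2 / ‖z.1 - z.2‖ₑ ^ ((finrank ℝ E : ℝ) / p + 1)) p (μ.prod μ))
      atTop (𝓝 0)) :
    ∀ᵐ z ∂μ.prod μ, d z.1 z.2 = 0 := by
  have hshear := measurePreserving_sub_prod μ μ
  have hlevel (k : ℕ) : dyadicLevel
      (fun z : E × E => d z.1 z.2 / ‖z.1 - z.2‖ₑ ^ ((finrank ℝ E : ℝ) / p + 1)) p (μ.prod μ) k =
        dyadicLevel (shiftedQuotient d p) p (μ.prod μ) k := by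
    have hmeas : MeasurableSet {z | 2 ^ k ≤ shiftedQuotient d p z} :=
      measurableSet_le measurable_const (measurable_shiftedQuotient hd p)
    rw [dyadicLevel, dyadicLevel, ← hshear.measure_preimage hmeas.nullMeasurableSet]
    simp only [preimage_ofPred_eq, shiftedQuotient, sub_add_cancel]
  have hshift := ae_shift_eq_zero_of_shellEnergy_eq_zero hd hd_self (zero_lt_one.trans_le hp)
    fun ρ hρ => shellEnergy_eq_zero_of_tendsto_dyadicLevel hd htri hd_le hp (hlim.congr hlevel) hρ
  filter_upwards [hshear.quasiMeasurePreserving.ae hshift] with z hz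
  rwa [sub_add_cancel] at hz

theorem ae_eq_const_of_lorentzQuasinorm_distQuotient_lt_top [MetricSpace F] (hp : 1 ≤ p)
    (hq : 0 < q) {u : E → F} (hu : AEStronglyMeasurable u μ)
    (h : lorentzQuasinorm (distQuotient p u) p q (μ.prod μ) < ∞) :
    ∃ c : F, ∀ᵐ x ∂μ, u x = c := by
  have hp0 : 0 < p := zero_lt_one.trans_le hp
  set d : E → E → ℝ≥0∞ := fun x y => min 1 (edist (hu.mk u x) (hu.mk u y))
  have hd : Measurable (Function.uncurry d) :=
    measurable_const.min ((hu.stronglyMeasurable_mk.comp_measurable measurable_fst).edist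
      (hu.stronglyMeasurable_mk.comp_measurable measurable_snd)).measurable
  have hmk : ∀ᵐ z ∂μ.prod μ, u z.1 = hu.mk u z.1 ∧ u z.2 = hu.mk u z.2 :=
    (Measure.quasiMeasurePreserving_fst.ae hu.ae_eq_mk).and
      (Measure.quasiMeasurePreserving_snd.ae hu.ae_eq_mk)
  have hle : ∀ᵐ z ∂μ.prod μ,
      d z.1 z.2 / ‖z.1 - z.2‖ₑ ^ ((finrank ℝ E : ℝ) / p + 1) ≤ ‖distQuotient p u z‖ₑ := by
    filter_upwards [hmk] with z hz
    refine le_trans ?_ (edist_div_le_enorm_distQuotient p u z)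
    rw [hz.1, hz.2]
    gcongr
    exact min_le_right _ _
  have hlim := tendsto_of_tendsto_of_tendsto_of_le_of_le tendsto_const_nhds
    (tendsto_dyadicLevel_of_lorentzQuasinorm_lt_top hp0 hq h) (fun _ => zero_le)
    (dyadicLevel_mono_ae hle)
  have hzero := ae_prod_eq_zero_of_tendsto_dyadicLevel hd (by simp [d])
    (fun _ _ _ => min_one_edist_triangle _ _ _) (fun _ _ => min_le_left _ _) hp hlim
  have heq : ∀ᵐ z ∂μ.prod μ, u z.1 = u z.2 := by
    filter_upwards [hzero, hmk] with z hz hz_mk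
    rw [hz_mk.1, hz_mk.2]
    exact edist_eq_zero.1 ((min_eq_bot.1 hz).resolve_left one_ne_zero)
  obtain ⟨x, hx⟩ := (Measure.ae_ae_of_ae_prod heq).exists
  exact ⟨u x, hx.mono fun y hy => hy.symm⟩

end Rigidity

theorem exists_contDiff_hasCompactSupport_not_ae_const {E : Type*} [NormedAddCommGroup E]
    [NormedSpace ℝ E] [FiniteDimensional ℝ E] [Nontrivial E] [MeasurableSpace E]
    (μ : Measure E) [μ.IsOpenPosMeasure] :
    ∃ φ : E → ℝ, ContDiff ℝ (⊤ : ℕ∞) φ ∧ HasCompactSupport φ ∧ ¬ ∃ c : ℝ, ∀ᵐ x ∂μ, φ x = c := by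
  let φ : ContDiffBump (0 : E) := ⟨1, 2, one_pos, one_lt_two⟩
  refine ⟨φ, φ.contDiff, φ.hasCompactSupport, ?_⟩
  rintro ⟨c, hc⟩
  have hconst : (φ : E → ℝ) = fun _ => c := Measure.eq_of_ae_eq hc φ.continuous continuous_const
  obtain ⟨x, hx⟩ := NormedSpace.exists_lt_norm ℝ E 2
  have hφ0 : φ 0 = 1 := φ.one_of_mem_closedBall (by simp [φ])
  have hφx : φ x = 0 := φ.zero_of_le_dist (by simpa [φ] using hx.le)
  rw [hconst] at hφ0 hφx
  exact one_ne_zero (hφ0.symm.trans hφx)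

theorem eLpNorm_gradient {E : Type*} [NormedAddCommGroup E] [InnerProductSpace ℝ E]
    [CompleteSpace E] [MeasurableSpace E] (u : E → ℝ) (p : ℝ≥0∞) (μ : Measure E) :
    eLpNorm (gradient u) p μ = eLpNorm (fderiv ℝ u) p μ :=
  eLpNorm_congr_norm_ae (.of_forall fun _ => LinearIsometryEquiv.norm_map _ _)

theorem theorem1_general {E F : Type*} [NormedAddCommGroup E] [NormedSpace ℝ E]
    [FiniteDimensional ℝ E] [Nontrivial E] [MeasurableSpace E] [BorelSpace E] [MetricSpace F]
    (μ : Measure E) [μ.IsAddHaarMeasure] {p q : ℝ} (hp : 1 ≤ p) (hq : 0 < q) :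
    (∀ u : E → F, AEStronglyMeasurable u μ →
      lorentzQuasinorm (distQuotient p u) p q (μ.prod μ) < ∞ →
      ∃ c : F, ∀ᵐ x ∂μ, u x = c) ∧
    ¬ ∃ C : ℝ≥0, ∀ u : E → ℝ, ContDiff ℝ (⊤ : ℕ∞) u → HasCompactSupport u →
      lorentzQuasinorm (distQuotient p u) p q (μ.prod μ) ≤
        (C : ℝ≥0∞) * eLpNorm (fderiv ℝ u) (ENNReal.ofReal p) μ := by
  refine ⟨fun u hu => ae_eq_const_of_lorentzQuasinorm_distQuotient_lt_top hp hq hu, ?_⟩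
  rintro ⟨C, hC⟩
  obtain ⟨φ, hφ, hφ_supp, hφ_const⟩ := exists_contDiff_hasCompactSupport_not_ae_const μ
  have hfderiv : eLpNorm (fderiv ℝ φ) (ENNReal.ofReal p) μ < ∞ :=
    ((hφ.continuous_fderiv (by simp)).memLp_of_hasCompactSupport (hφ_supp.fderiv ℝ)).2
  exact hφ_const (ae_eq_const_of_lorentzQuasinorm_distQuotient_lt_top hp hq
    hφ.continuous.aestronglyMeasurable
    ((hC φ hφ hφ_supp).trans_lt (ENNReal.mul_lt_top ENNReal.coe_lt_top hfderiv)))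

theorem theorem1 (N : ℕ) (hN : 1 ≤ N) (p q : ℝ) (hp : 1 ≤ p) (hq : 1 ≤ q) :
    (∀ u : EuclideanSpace ℝ (Fin N) → ℝ, AEMeasurable u volume →
      lorentzQuasinorm (diffQuotient p u) p q volume < ∞ →
      ∃ c : ℝ, ∀ᵐ x ∂(volume : Measure (EuclideanSpace ℝ (Fin N))), u x = c) ∧
    ¬ ∃ C : ℝ≥0, ∀ u : EuclideanSpace ℝ (Fin N) → ℝ,
      ContDiff ℝ (⊤ : ℕ∞) u → HasCompactSupport u →
      lorentzQuasinorm (diffQuotient p u) p q volume ≤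
        (C : ℝ≥0∞) * eLpNorm (gradient u) (ENNReal.ofReal p) volume := by
  have : Nonempty (Fin N) := ⟨⟨0, hN⟩⟩
  simpa only [lorentzQuasinorm_congr_abs (abs_distQuotient p _), eLpNorm_gradient,
    Measure.volume_eq_prod, aestronglyMeasurable_iff_aemeasurable] using
    theorem1_general (F := ℝ) (volume : Measure (EuclideanSpace ℝ (Fin N))) hp
      (zero_lt_one.trans_le hq)
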